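/- Let $U$ be a real separable Hilbert space and let $\Lambda:D(\Lambda)\subset U\to U$ be a positive self-adjoint operator with a bounded inverse $\Lambda^{-1}$ of trace class. Let $V'$ be the dual of $V=D(\Lambda^{1/2})$, i.e. the completion of $U$ for the norm $\|x\|_{V'}=\|\Lambda^{-1/2}x\|_U$; extend $\Lambda$ to a self-adjoint operator on $V'$ (with domain $V$), still denoted $\Lambda$, and let $\Lambda^s$ denote its powers on $V'$. Let $\alpha\in[0,1)$ and $\rho>0$ be such that $\rho^2\neq 4\mu^{1-2\alpha}$ for every eigenvalue $\mu$ of $\Lambda$. Put $H=U\times V'$, $\widetilde H=V'\times V'$, $Ga=(0,a)$ for $a\in V'$, and $$\mathcal A_{\alpha,\rho}(z_1,z_2)=(z_2,\,-\Lambda z_1-\rho\Lambda^\alpha z_2)\ \text{ in } H,\qquad \widetilde{\mathcal A}_{\alpha,\rho}(y_1,y_2)=(\Lambda^{1/2}y_2,\,-\Lambda^{1/2}y_1-\rho\Lambda^\alpha y_2)\ \text{ in }\widetilde H,$$ with domains $D(\Lambda)\times D(\Lambda^{\frac12\vee\alpha})$ and $D(\Lambda^{1/2})\times D(\Lambda^{\frac12\vee\alpha})$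 (powers on $V'$). Solutions of $z'=\mathcal A_{\alpha,\rho}z+Gu$, $z(0)=k$ in $H$, and of $y'=\widetilde{\mathcal A}_{\alpha,\rho}y+Gu$, $y(0)=k$ in $\widetilde H$, are mild solutions for the strongly continuous semigroups generated by (the closures of) these operators. For $0<t\le T$ let $$\mathcal E_C(t,k)=\inf\Big\{\int_0^t\|u(s)\|_{V'}^2\,ds:\ u\in L^2(0,T;V'),\ z(0)=k,\ z(t)=0\Big\},$$ and let $\widetilde{\mathcal E}_C(t,k)$ be the analogous infimum for the system in $\widetilde H$ (with $\inf\emptyset=+\infty$). Then there is a constant $C>0$ such that for all $a\in V'$ and all $0<t\le T$, with $k=Ga$, $$\widetilde{\mathcal E}_C(t,k)\le\frac{C\|a\|_{V'}^2}{t},\qquad \widetilde{\mathcal E}_C(t,k)=\mathcal E_C(t,k),\qquad \mathcal E_C(t,k)\le\frac{C\|a\|_{V'}^2}{t}.$$ Moreover, in both systems $Ga$ is steered to $0$ at time $t$ by a control $v\in L^2(0,T;V')$ with $\int_0^t\|v(s)\|^2_{V'}ds\le C\|a\|^2_{V'}/t$ which on $[0,t]$ equals $v_0+v_1'$, where, for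 every eigenvector $e\in V'$ of $\Lambda$ with eigenvalue $\mu$, $$\langle v_0(s),e\rangle_{V'}=-\frac{\lambda^-e^{\lambda^+s}-\lambda^+e^{\lambda^-s}}{\lambda^--\lambda^+}\,\phi_t(s)\,\langle a,e\rangle_{V'},\qquad \langle v_1(s),e\rangle_{V'}=-\frac{-e^{\lambda^+s}+e^{\lambda^-s}}{\lambda^--\lambda^+}\,\phi_t(s)\,\langle a,e\rangle_{V'},$$ with $\lambda^\pm=\frac12\big(-\rho\mu^\alpha\pm\sqrt{\rho^2\mu^{2\alpha}-4\mu}\big)$ and $\phi_t(s)=s^2(t-s)^2\big/\int_0^t r^2(t-r)^2\,dr$. -/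

import Mathlib

open MeasureTheory Filter Topology Set
open scoped ENNReal

noncomputable section

namespace DampedWave

/-! ### Unbounded operators, given by their graphs, and strongly continuous semigroups -/

section Abstract

variable {E : Type*} [NormedAddCommGroup E] [InnerProductSpace ℝ E]
variable {F : Type*} [NormedAddCommGroup F] [InnerProductSpace ℝ F]

/-- A bounded operator on a Hilbert space is of trace class (nuclear) if it is a sum
`∑ ⟪x n, ·⟫ y n` of rank-one operators with `∑ ‖x n‖ ‖y n‖ < ∞`. -/
def IsTraceClass (R : E →L[ℝ] E) : Prop :=
  ∃ x y : ℕ → E, Summable (fun n => ‖x n‖ * ‖y n‖) ∧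
    ∀ z, HasSum (fun n => inner ℝ (x n) z • y n) (R z)

/-- The graph of the power `A ^ s` of a positive self-adjoint operator with graph `A` whose
eigenvectors are complete: `x ∈ D(A ^ s)` and `A ^ s x = y` if and only if, along each
eigenvector `e` with eigenvalue `μ`, the coefficient of `y` is `μ ^ s` times that of `x`. -/
def spectralPower (A : Set (E × E)) (s : ℝ) : Set (E × E) :=
  {p | ∀ (e : E) (μ : ℝ), (e, μ • e) ∈ A → inner ℝ p.2 e = μ ^ s * inner ℝ p.1 e}

/-- `S` restricted to `[0, ∞)` is a strongly continuous semigroup of bounded operators. -/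
structure IsC0Semigroup (S : ℝ → E →L[ℝ] E) : Prop where
  map_zero : S 0 = ContinuousLinearMap.id ℝ E
  map_add : ∀ s t, 0 ≤ s → 0 ≤ t → S (s + t) = (S s).comp (S t)
  tendsto_zero : ∀ x, Tendsto (fun t => S t x) (𝓝[>] 0) (𝓝 x)

/-- The graph of the infinitesimal generator of `S`. -/
def generatorGraph (S : ℝ → E →L[ℝ] E) : Set (E × E) :=
  {p | Tendsto (fun h : ℝ => h⁻¹ • (S h p.1 - p.1)) (𝓝[>] 0) (𝓝 p.2)}

/-- `y` is, on `[0, T]`, the mild solution of `y' = A y + B u`, `y(0) = k`, where the closure of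
the operator with graph `A` generates a strongly continuous semigroup. -/
def IsMildSolution (A : Set (E × E)) (B : F →L[ℝ] E) (T : ℝ) (k : E) (u : ℝ → F)
    (y : ℝ → E) : Prop :=
  ∃ S : ℝ → E →L[ℝ] E, IsC0Semigroup S ∧ generatorGraph S = closure A ∧
    ∀ t ∈ Icc 0 T, y t = S t k + ∫ r in (0 : ℝ)..t, S (t - r) (B (u r))

/-- The control `u ∈ L²(0, T; F)` steers `k` to `0` at time `t` in `y' = A y + B u`. -/
def Steers (A : Set (E × E)) (B : F →L[ℝ] E) (T t : ℝ) (k : E) (u : ℝ → F) : Prop :=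
  MemLp u 2 (volume.restrict (Ioc 0 T)) ∧ ∃ y, IsMildSolution A B T k u y ∧ y t = 0

/-- The minimal energy needed to steer `k` to `0` at time `t` (`∞` if this is impossible). -/
def controlEnergy (A : Set (E × E)) (B : F →L[ℝ] E) (T t : ℝ) (k : E) : ℝ≥0∞ :=
  ⨅ (u : ℝ → F) (_ : Steers A B T t k u), ∫⁻ s in Ioc 0 t, ‖u s‖ₑ ^ 2

end Abstract

/-! ### The operator `Λ` and the space `V'` -/

/-- A positive self-adjoint operator `Λ : D(Λ) ⊂ U → U` together with its bounded inverse. -/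
structure PosOp (U : Type*) [NormedAddCommGroup U] [InnerProductSpace ℝ U] [CompleteSpace U] where
  op : U →ₗ.[ℝ] U
  selfAdjoint : IsSelfAdjoint op
  nonneg : ∀ x : op.domain, 0 ≤ inner ℝ (op x) (x : U)
  inv : U →L[ℝ] U
  inv_mem : ∀ x, inv x ∈ op.domain
  op_inv : ∀ x, op ⟨inv x, inv_mem x⟩ = x
  inv_op : ∀ x : op.domain, inv (op x) = x

variable {U : Type*} [NormedAddCommGroup U] [InnerProductSpace ℝ U] [CompleteSpace U]

namespace PosOp

theorem inv_symm (Λ : PosOp U) (x y : U) : inner ℝ (Λ.inv x) y = inner ℝ x (Λ.inv y) := by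
  have h := LinearPMap.adjoint_isFormalAdjoint (T := Λ.op) Λ.selfAdjoint.dense_domain
  rw [LinearPMap.isSelfAdjoint_def.1 Λ.selfAdjoint] at h
  have := h ⟨Λ.inv x, Λ.inv_mem x⟩ ⟨Λ.inv y, Λ.inv_mem y⟩
  rw [Λ.op_inv, Λ.op_inv] at this
  exact this.symm

theorem inv_nonneg (Λ : PosOp U) (x : U) : 0 ≤ inner ℝ (Λ.inv x) x := by
  have := Λ.nonneg ⟨Λ.inv x, Λ.inv_mem x⟩
  rw [Λ.op_inv] at this
  rwa [real_inner_comm]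

theorem inv_definite (Λ : PosOp U) (x : U) (hx : inner ℝ (Λ.inv x) x = 0) : x = 0 := by
  have key : inner ℝ (Λ.inv x) (Λ.inv x) = 0 := by
    by_contra hne
    set q := inner ℝ (Λ.inv x) (Λ.inv x)
    set r := inner ℝ (Λ.inv (Λ.inv x)) (Λ.inv x)
    have h := Λ.inv_nonneg ((-(r + 1) / (2 * q)) • x + Λ.inv x)
    simp only [map_add, map_smul, inner_add_left, inner_add_right, inner_smul_left,
      inner_smul_right, hx, Λ.inv_symm (Λ.inv x) x] at h
    change 0 ≤ _ * (_ * 0 + q) + (_ * q + r) at h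
    have h2 : (-(r + 1) / (2 * q)) * q = -(r + 1) / 2 := by field_simp
    simp only [conj_trivial, mul_zero, zero_add, h2] at h
    linarith
  have h0 : Λ.inv x = 0 := inner_self_eq_zero.1 key
  have h1 := Λ.op_inv x
  have h2 : (⟨Λ.inv x, Λ.inv_mem x⟩ : Λ.op.domain) = 0 := Subtype.ext h0
  rw [h2, LinearPMap.map_zero] at h1
  exact h1.symm

end PosOp

/-- The space `U`, to be equipped with the inner product `⟪Λ⁻¹ x, y⟫ = ⟪Λ^(-1/2) x, Λ^(-1/2) y⟫`. -/
def PreVDual (_Λ : PosOp U) := U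

instance (Λ : PosOp U) : AddCommGroup (PreVDual Λ) := inferInstanceAs (AddCommGroup U)

instance (Λ : PosOp U) : Module ℝ (PreVDual Λ) := inferInstanceAs (Module ℝ U)

/-- The identity map from `U` to `PreVDual Λ`. -/
def PreVDual.of (Λ : PosOp U) : U →ₗ[ℝ] PreVDual Λ := LinearMap.id

/-- The identity map from `PreVDual Λ` to `U`. -/
def PreVDual.out (Λ : PosOp U) : PreVDual Λ →ₗ[ℝ] U := LinearMap.id

@[reducible]
def PreVDual.core (Λ : PosOp U) : InnerProductSpace.Core ℝ (PreVDual Λ) where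
  inner x y := inner ℝ (Λ.inv (PreVDual.out Λ x)) (PreVDual.out Λ y)
  conj_inner_symm x y := by
    rw [Λ.inv_symm (PreVDual.out Λ y), real_inner_comm, conj_trivial]
  re_inner_nonneg x := Λ.inv_nonneg (PreVDual.out Λ x)
  add_left x y z := by simp [inner_add_left]
  smul_left x y r := by simp [inner_smul_left]
  definite x hx := Λ.inv_definite (PreVDual.out Λ x) hx

instance (Λ : PosOp U) : NormedAddCommGroup (PreVDual Λ) :=
  (PreVDual.core Λ).toNormedAddCommGroup

instance (Λ : PosOp U) : InnerProductSpace ℝ (PreVDual Λ) :=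
  InnerProductSpace.ofCore (PreVDual.core Λ).toCore

/-- `V'`, the dual of `V = D(Λ^(1/2))`, realised as the completion of `U` for the dual norm
`‖x‖ = ‖Λ^(-1/2) x‖`. -/
abbrev VDual (Λ : PosOp U) := UniformSpace.Completion (PreVDual Λ)

/-- The inclusion `U ⊂ V'`. -/
def incl (Λ : PosOp U) : U →ₗ[ℝ] VDual Λ :=
  (UniformSpace.Completion.toComplₗᵢ (𝕜 := ℝ) (E := PreVDual Λ)).toLinearMap.comp (PreVDual.of Λ)

/-- The graph of the extension of `Λ` to a self-adjoint operator on `V'` (with domain `V`): the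
closure in `V' × V'` of the graph of `Λ`. -/
def extGraph (Λ : PosOp U) : Set (VDual Λ × VDual Λ) :=
  closure {p | ∃ x : Λ.op.domain, p = (incl Λ (x : U), incl Λ (Λ.op x))}

/-- The graph of the power `Λ ^ s` on `V'`. -/
def powGraph (Λ : PosOp U) (s : ℝ) : Set (VDual Λ × VDual Λ) := spectralPower (extGraph Λ) s

/-! ### The damped wave operators and the control system -/

/-- The Hilbert space `H = U × V'`. -/
abbrev StateH (Λ : PosOp U) := WithLp 2 (U × VDual Λ)

/-- The Hilbert space `H̃ = V' × V'`. -/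
abbrev StateHt (Λ : PosOp U) := WithLp 2 (VDual Λ × VDual Λ)

/-- `a ↦ (0, a)` from `V'` to `H = U × V'`. -/
def G (Λ : PosOp U) : VDual Λ →L[ℝ] StateH Λ :=
  (WithLp.prodContinuousLinearEquiv 2 ℝ U (VDual Λ)).symm.toContinuousLinearMap.comp
    (ContinuousLinearMap.inr ℝ U (VDual Λ))

/-- `a ↦ (0, a)` from `V'` to `H̃ = V' × V'`. -/
def Gt (Λ : PosOp U) : VDual Λ →L[ℝ] StateHt Λ :=
  (WithLp.prodContinuousLinearEquiv 2 ℝ (VDual Λ) (VDual Λ)).symm.toContinuousLinearMap.comp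
    (ContinuousLinearMap.inr ℝ (VDual Λ) (VDual Λ))

/-- The graph of `(z₁, z₂) ↦ (z₂, -Λ z₁ - ρ Λ^α z₂)` in `H`, with domain all `(z₁, z₂)` such that
`z₁ ∈ D(Λ) = V`, `z₂ ∈ U` and `z₂ ∈ D(Λ^α)`. -/
def waveGraph (Λ : PosOp U) (α ρ : ℝ) : Set (StateH Λ × StateH Λ) :=
  {p | incl Λ p.2.fst = p.1.snd ∧
    ∃ b c : VDual Λ, (incl Λ p.1.fst, b) ∈ extGraph Λ ∧ (p.1.snd, c) ∈ powGraph Λ α ∧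
      p.2.snd = -b - ρ • c}

/-- The graph of `(y₁, y₂) ↦ (Λ^(1/2) y₂, -Λ^(1/2) y₁ - ρ Λ^α y₂)` in `H̃`, with domain all
`(y₁, y₂)` such that `y₁ ∈ D(Λ^(1/2))` and `y₂ ∈ D(Λ^(1/2)) ∩ D(Λ^α)`. -/
def waveGraphT (Λ : PosOp U) (α ρ : ℝ) : Set (StateHt Λ × StateHt Λ) :=
  {p | (p.1.snd, p.2.fst) ∈ powGraph Λ (1 / 2) ∧
    ∃ b c : VDual Λ, (p.1.fst, b) ∈ powGraph Λ (1 / 2) ∧ (p.1.snd, c) ∈ powGraph Λ α ∧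
      p.2.snd = -b - ρ • c}

/-! ### The spectral control -/

/-- The root `λ⁺` of `z² + ρ μ^α z + μ = 0`. -/
def rootP (α ρ μ : ℝ) : ℂ :=
  (-((ρ * μ ^ α : ℝ) : ℂ) + ((ρ ^ 2 * μ ^ (2 * α) - 4 * μ : ℝ) : ℂ) ^ (1 / 2 : ℂ)) / 2

/-- The root `λ⁻` of `z² + ρ μ^α z + μ = 0`. -/
def rootM (α ρ μ : ℝ) : ℂ :=
  (-((ρ * μ ^ α : ℝ) : ℂ) - ((ρ ^ 2 * μ ^ (2 * α) - 4 * μ : ℝ) : ℂ) ^ (1 / 2 : ℂ)) / 2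

/-- `φ_t(s) = s² (t - s)² / ∫₀ᵗ r² (t - r)² dr`. -/
def bump (t s : ℝ) : ℝ := s ^ 2 * (t - s) ^ 2 / ∫ r in (0 : ℝ)..t, r ^ 2 * (t - r) ^ 2

/-- The coefficient at time `s` of the part `v₀` of the control along an eigenvector with
eigenvalue `μ`, relative to that of the state to be steered. -/
def coeffZero (α ρ μ t s : ℝ) : ℂ :=
  -((rootM α ρ μ * Complex.exp (rootP α ρ μ * s) - rootP α ρ μ * Complex.exp (rootM α ρ μ * s)) /
    (rootM α ρ μ - rootP α ρ μ)) * bump t s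

/-- The same for the part `v₁`. -/
def coeffOne (α ρ μ t s : ℝ) : ℂ :=
  -((-Complex.exp (rootP α ρ μ * s) + Complex.exp (rootM α ρ μ * s)) /
    (rootM α ρ μ - rootP α ρ μ)) * bump t s

/-- On `[0, t]`, `v` is the control `v₀ + v₁'` attached to `a`. -/
def IsSpectralControl (Λ : PosOp U) (α ρ t : ℝ) (a : VDual Λ) (v : ℝ → VDual Λ) : Prop :=
  ∀ s ∈ Icc 0 t, ∀ (e : VDual Λ) (μ : ℝ), (e, μ • e) ∈ extGraph Λ →
    ((inner ℝ (v s) e : ℝ) : ℂ) =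
      (coeffZero α ρ μ t s + deriv (coeffOne α ρ μ t) s) * ((inner ℝ a e : ℝ) : ℂ)

end DampedWave

end

/-! Since `Λ.inv` is compact, symmetric and positive definite, `U` has a Hilbert basis of
eigenvectors of `Λ`; rescaled by `√μ` it becomes one of `V'`. In these coordinates both wave
operators are the same block-diagonal operator on `ℓ²(ι; ℂ)`, with blocks `A = blockOp √μ β`, `β = ρ
μ^α`, and both input maps send `a` to the sequence `aᵢ • I`. The two systems are thus isometric over
the same space of controls, so a control steers in one exactly when it steers in the other, and the
energies agree (`waveGraphT_eq`, `waveGraph_eq`, `controlEnergy_eq`).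

It remains to steer each block. Let `d` (`position`) solve `d'' + β d' + m² d = 0`, `d(0) = 0`,
`d'(0) = 1`. Because `A² + β A + m² = 0`, one has `e^{sA} I = (d' + β d) I + d A I`. If `φ` has
integral `1` on `[0, t]`, then `e^{tA} I` is the integral of `φ(r) e^{(t-r)A} e^{rA} I`. Integrating
the `A I` part by parts moves it onto `I`, which gives the scalar control `-(d' + β d) φ - (d φ)'`
(`integral_flow_controlCoeff`). Expressed through the roots `λ^±`, this is the stated `v₀ + v₁'`
(`coeffZero_add_deriv_coeffOne`).

The bound must not depend on `μ`. Each block is dissipative, so `d'` and `d' + β d`, being entries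
of a contraction, are at most `1` in absolute value, and `|d(s)| ≤ s`. With `φ = O(1/t)` and `φ' =
O(1/t²)` the control is at most `20/t` times the datum in every mode (`abs_controlCoeff_le`), hence
has energy at most `400 ‖a‖² / t`. -/

noncomputable section

namespace DampedWave

/-! ### Transport of control systems along isometries -/

section Transport

variable {E : Type*} [NormedAddCommGroup E] [InnerProductSpace ℝ E]
variable {E' : Type*} [NormedAddCommGroup E'] [InnerProductSpace ℝ E']
variable {F : Type*} [NormedAddCommGroup F] [InnerProductSpace ℝ F]

/-- The operator `J ∘ S ∘ J⁻¹`. -/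
def conjOp (J : E ≃ₗᵢ[ℝ] E') (S : E →L[ℝ] E) : E' →L[ℝ] E' :=
  (J.toContinuousLinearEquiv : E →L[ℝ] E').comp
    (S.comp (J.symm.toContinuousLinearEquiv : E' →L[ℝ] E))

@[simp]
theorem conjOp_apply (J : E ≃ₗᵢ[ℝ] E') (S : E →L[ℝ] E) (x : E') :
    conjOp J S x = J (S (J.symm x)) := rfl

theorem IsC0Semigroup.conj (J : E ≃ₗᵢ[ℝ] E') {S : ℝ → E →L[ℝ] E} (h : IsC0Semigroup S) :
    IsC0Semigroup (fun t => conjOp J (S t)) where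
  map_zero := by ext x; simp [h.map_zero]
  map_add s t hs ht := by ext x; simp [h.map_add s t hs ht]
  tendsto_zero x := by
    have := (J.continuous.tendsto _).comp (h.tendsto_zero (J.symm x))
    simpa [Function.comp_def] using this

theorem mem_generatorGraph_conjOp (J : E ≃ₗᵢ[ℝ] E') (S : ℝ → E →L[ℝ] E) (p : E' × E') :
    p ∈ generatorGraph (fun t => conjOp J (S t)) ↔
      (J.symm p.1, J.symm p.2) ∈ generatorGraph S := by
  refine (J.symm.toHomeomorph.isInducing.tendsto_nhds_iff (y := p.2)).trans ?_
  simp [generatorGraph, Function.comp_def]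

theorem closure_isometry_preimage (J : E ≃ₗᵢ[ℝ] E') (A : Set (E' × E')) :
    closure {p : E × E | (J p.1, J p.2) ∈ A} = {p | (J p.1, J p.2) ∈ closure A} :=
  ((J.toHomeomorph.prodCongr J.toHomeomorph).preimage_closure A).symm

theorem Steers.map (J : E ≃ₗᵢ[ℝ] E') {A : Set (E × E)} {A' : Set (E' × E')}
    (hA : A = {p | (J p.1, J p.2) ∈ A'}) {B : F →L[ℝ] E} {B' : F →L[ℝ] E'}
    (hB : ∀ a, J (B a) = B' a) {T t : ℝ} {k : E} {u : ℝ → F} (h : Steers A B T t k u) :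
    Steers A' B' T t (J k) u := by
  obtain ⟨hu, y, ⟨S, hS, hgen, hy⟩, hyt⟩ := h
  refine ⟨hu, fun s => J (y s), ⟨fun s => conjOp J (S s), hS.conj J, ?_, ?_⟩, by simp [hyt]⟩
  · ext p
    rw [mem_generatorGraph_conjOp, hgen, hA, closure_isometry_preimage]
    simp
  · intro s hs
    -- No integrability of the integrand is known here; an invertible `J` commutes with the Bochner
    -- integral regardless.
    have hint : J (∫ r in (0 : ℝ)..s, S (s - r) (B (u r))) =
        ∫ r in (0 : ℝ)..s, J (S (s - r) (B (u r))) := by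
      simp only [intervalIntegral.intervalIntegral_eq_integral_uIoc, map_smul]
      congr 1
      exact (J.toContinuousLinearEquiv.integral_comp_comm _).symm
    simp only [hy s hs, map_add, hint, conjOp_apply, J.symm_apply_apply, ← hB]

theorem steers_iff (J : E ≃ₗᵢ[ℝ] E') {A : Set (E × E)} {A' : Set (E' × E')}
    (hA : A = {p | (J p.1, J p.2) ∈ A'}) {B : F →L[ℝ] E} {B' : F →L[ℝ] E'}
    (hB : ∀ a, J (B a) = B' a) {T t : ℝ} {k : E} {u : ℝ → F} :
    Steers A B T t k u ↔ Steers A' B' T t (J k) u := by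
  refine ⟨Steers.map J hA hB, fun h => ?_⟩
  have := Steers.map J.symm (A := A') (A' := A) (B' := B) (by rw [hA]; simp)
    (fun a => by rw [← hB, J.symm_apply_apply]) h
  simpa using this

/-- The isometry acts on states only, so both infima run over the same controls with the same cost.
-/
theorem controlEnergy_eq (J : E ≃ₗᵢ[ℝ] E') {A : Set (E × E)} {A' : Set (E' × E')}
    (hA : A = {p | (J p.1, J p.2) ∈ A'}) {B : F →L[ℝ] E} {B' : F →L[ℝ] E'}
    (hB : ∀ a, J (B a) = B' a) (T t : ℝ) (k : E) :
    controlEnergy A B T t k = controlEnergy A' B' T t (J k) := by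
  simp only [controlEnergy, steers_iff J hA hB]

end Transport

/-! ### Block-diagonal contraction semigroups on a Hilbert sum -/

section BlockDiagonal

variable {ι : Type*} {G : Type*} [NormedAddCommGroup G]

theorem summable_sq_norm_lp (x : lp (fun _ : ι => G) 2) : Summable fun i => ‖x i‖ ^ 2 := by
  have := (lp.memℓp x).summable (by norm_num)
  simpa using this

theorem norm_sq_lp (x : lp (fun _ : ι => G) 2) : ‖x‖ ^ 2 = ∑' i, ‖x i‖ ^ 2 := by
  have := lp.norm_rpow_eq_tsum (p := 2) (by norm_num) x
  simpa using this

/-- Dominated convergence in a Hilbert sum. -/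
theorem tendsto_lp_of_dominated {X : Type*} {l : Filter X} {f : X → lp (fun _ : ι => G) 2}
    {x : lp (fun _ : ι => G) 2} {g : ι → ℝ} (hg : Summable fun i => g i ^ 2)
    (hb : ∀ᶠ n in l, ∀ i, ‖f n i‖ ≤ g i)
    (hl : ∀ i, Tendsto (fun n => f n i) l (𝓝 (x i))) : Tendsto f l (𝓝 x) := by
  have key : Tendsto (fun n => ∑' i, ‖(f n - x) i‖ ^ 2) l (𝓝 (∑' _ : ι, (0 : ℝ))) := by
    refine tendsto_tsum_of_dominated_convergence
      (bound := fun i => 2 * g i ^ 2 + 2 * ‖x i‖ ^ 2)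
      ((hg.mul_left 2).add ((summable_sq_norm_lp x).mul_left 2)) ?_ ?_
    · intro i
      have := ((hl i).sub_const (x i)).norm.pow 2
      simpa using this
    · filter_upwards [hb] with n hn i
      have h1 : ‖(f n - x) i‖ ≤ g i + ‖x i‖ := by
        rw [lp.coeFn_sub, Pi.sub_apply]
        exact (norm_sub_le _ _).trans (by gcongr; exact hn i)
      rw [Real.norm_of_nonneg (by positivity)]
      have h2 : ‖(f n - x) i‖ ^ 2 ≤ (g i + ‖x i‖) ^ 2 := by gcongr
      nlinarith [sq_nonneg (g i - ‖x i‖)]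
  simp only [tsum_zero, ← norm_sq_lp] at key
  rw [tendsto_iff_norm_sub_tendsto_zero]
  have := key.sqrt
  simpa [Real.sqrt_sq (norm_nonneg _)] using this

variable [InnerProductSpace ℝ G]

/-- The block-diagonal operator with the contractions `L i` as blocks. -/
def blockDiag (L : ι → G →L[ℝ] G) (hL : ∀ i z, ‖L i z‖ ≤ ‖z‖) :
    lp (fun _ : ι => G) 2 →L[ℝ] lp (fun _ : ι => G) 2 :=
  LinearMap.mkContinuous
    { toFun := fun x => ⟨fun i => L i (x i), (lp.memℓp x).mono' fun i => hL i (x i)⟩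
      map_add' := fun x y => by ext i; exact map_add (L i) _ _
      map_smul' := fun c x => by ext i; simp } 1 fun x => by
    rw [one_mul]
    exact lp.norm_mono (by norm_num) fun i => hL i (x i)

@[simp]
theorem blockDiag_apply (L : ι → G →L[ℝ] G) (hL : ∀ i z, ‖L i z‖ ≤ ‖z‖)
    (x : lp (fun _ : ι => G) 2) (i : ι) : blockDiag L hL x i = L i (x i) := rfl

/-- The uniformly continuous group generated by a bounded operator. -/
def flow (A : G →L[ℝ] G) (s : ℝ) : G →L[ℝ] G := NormedSpace.exp (s • A)

theorem flow_zero (A : G →L[ℝ] G) : flow A 0 = ContinuousLinearMap.id ℝ G := by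
  simp [flow, NormedSpace.exp_zero, ContinuousLinearMap.one_def]

variable [CompleteSpace G]

theorem flow_add (A : G →L[ℝ] G) (s t : ℝ) : flow A (s + t) = (flow A s).comp (flow A t) := by
  let _ : NormedAlgebra ℚ (G →L[ℝ] G) := NormedAlgebra.restrictScalars ℚ ℝ _
  rw [flow, add_smul, NormedSpace.exp_add_of_commute]
  · rfl
  · exact ((Commute.refl A).smul_left s).smul_right t

theorem hasDerivAt_flow (A : G →L[ℝ] G) (z : G) (s : ℝ) :
    HasDerivAt (fun r => flow A r z) (flow A s (A z)) s :=
  ((hasDerivAt_exp_smul_const A s).clm_apply (hasDerivAt_const s z)).congr_deriv (by simp [flow])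

theorem hasDerivAt_flow_left (A : G →L[ℝ] G) (z : G) (s : ℝ) :
    HasDerivAt (fun r => flow A r z) (A (flow A s z)) s :=
  ((hasDerivAt_exp_smul_const' A s).clm_apply (hasDerivAt_const s z)).congr_deriv (by simp [flow])

theorem flow_comm (A : G →L[ℝ] G) (z : G) (s : ℝ) : flow A s (A z) = A (flow A s z) :=
  (hasDerivAt_flow A z s).unique (hasDerivAt_flow_left A z s)

/-- A dissipative operator generates a contraction semigroup. -/
theorem norm_flow_le {A : G →L[ℝ] G} (hA : ∀ z, inner ℝ (A z) z ≤ 0) {s : ℝ} (hs : 0 ≤ s)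
    (z : G) : ‖flow A s z‖ ≤ ‖z‖ := by
  have hd : ∀ r, HasDerivAt (fun r => ‖flow A r z‖ ^ 2)
      (2 * inner ℝ (flow A r z) (A (flow A r z))) r := fun r =>
    (hasDerivAt_flow_left A z r).norm_sq
  have hanti : Antitone fun r => ‖flow A r z‖ ^ 2 :=
    antitone_of_hasDerivAt_nonpos hd fun r => by
      simp only [Pi.zero_apply]
      have := hA (flow A r z)
      rw [real_inner_comm] at this
      linarith
  have := hanti hs
  simp only [flow_zero, ContinuousLinearMap.id_apply] at this
  exact (sq_le_sq₀ (norm_nonneg _) (norm_nonneg _)).1 this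

/-- The semigroup on the Hilbert sum whose blocks are generated by the dissipative operators
`A i`, extended by the identity to negative times. -/
def blockSemigroup (A : ι → G →L[ℝ] G) (hA : ∀ i z, inner ℝ (A i z) z ≤ 0) (t : ℝ) :
    lp (fun _ : ι => G) 2 →L[ℝ] lp (fun _ : ι => G) 2 :=
  blockDiag (fun i => flow (A i) (max t 0)) fun i z => norm_flow_le (hA i) (le_max_right _ _) z

theorem blockSemigroup_apply (A : ι → G →L[ℝ] G) (hA : ∀ i z, inner ℝ (A i z) z ≤ 0) {t : ℝ}
    (ht : 0 ≤ t) (x : lp (fun _ : ι => G) 2) (i : ι) :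
    blockSemigroup A hA t x i = flow (A i) t (x i) := by
  simp [blockSemigroup, max_eq_left ht]

theorem isC0Semigroup_blockSemigroup (A : ι → G →L[ℝ] G)
    (hA : ∀ i z, inner ℝ (A i z) z ≤ 0) : IsC0Semigroup (blockSemigroup A hA) where
  map_zero := by
    ext x i
    simp [blockSemigroup_apply, flow_zero]
  map_add s t hs ht := by
    ext x i
    simp [blockSemigroup_apply, hs, ht, add_nonneg, flow_add]
  tendsto_zero x := by
    refine tendsto_lp_of_dominated (summable_sq_norm_lp x) ?_ fun i => ?_
    · filter_upwards [self_mem_nhdsWithin] with t ht i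
      rw [blockSemigroup_apply A hA (le_of_lt ht)]
      exact norm_flow_le (hA i) (le_of_lt ht) _
    · have h := ((hasDerivAt_flow (A i) (x i) 0).continuousAt.tendsto).mono_left
        (nhdsWithin_le_nhds (s := Ioi 0))
      simp only [flow_zero, ContinuousLinearMap.id_apply] at h
      refine h.congr' ?_
      filter_upwards [self_mem_nhdsWithin] with t ht
      rw [blockSemigroup_apply A hA (le_of_lt ht)]

/-- The derivative of `flow A r z` is `flow A r (A z)`, of norm at most `‖A z‖`. The resulting bound
on difference quotients is the dominating sequence for the generator of the block semigroup. -/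
theorem norm_flow_sub_le {A : G →L[ℝ] G} (hA : ∀ z, inner ℝ (A z) z ≤ 0) {s : ℝ} (hs : 0 ≤ s)
    (z : G) : ‖flow A s z - z‖ ≤ s * ‖A z‖ := by
  have := norm_image_sub_le_of_norm_deriv_le_segment' (f := fun r => flow A r z) (a := 0) (b := s)
    (C := ‖A z‖) (fun r _ => (hasDerivAt_flow A z r).hasDerivWithinAt)
    (fun r hr => norm_flow_le hA hr.1 _) s (right_mem_Icc.2 hs)
  simpa [flow_zero, mul_comm] using this

/-- The generator is the diagonal operator on its maximal domain. Limits of difference quotients are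
read off coordinatewise; conversely the `i`-th quotient is dominated by `‖A i (p.1 i)‖ = ‖p.2 i‖`,
which is square-summable. -/
theorem generatorGraph_blockSemigroup (A : ι → G →L[ℝ] G)
    (hA : ∀ i z, inner ℝ (A i z) z ≤ 0) :
    generatorGraph (blockSemigroup A hA) = {p | ∀ i, p.2 i = A i (p.1 i)} := by
  ext p
  have hcoord : ∀ i, Tendsto (fun h : ℝ => (h⁻¹ • (blockSemigroup A hA h p.1 - p.1)) i) (𝓝[>] 0)
      (𝓝 (A i (p.1 i))) := by
    intro i
    have h := (hasDerivAt_flow (A i) (p.1 i) 0).tendsto_slope_zero_right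
    simp only [flow_zero, ContinuousLinearMap.id_apply, zero_add] at h
    refine h.congr' ?_
    filter_upwards [self_mem_nhdsWithin] with t ht
    rw [lp.coeFn_smul, Pi.smul_apply, lp.coeFn_sub, Pi.sub_apply,
      blockSemigroup_apply A hA (le_of_lt ht)]
  constructor
  · intro hp i
    exact tendsto_nhds_unique (((lp.evalCLM ℝ (fun _ : ι => G) 2 i).continuous.tendsto _).comp hp)
      (hcoord i)
  · intro hp
    refine tendsto_lp_of_dominated (summable_sq_norm_lp p.2) ?_ fun i => ?_
    · filter_upwards [self_mem_nhdsWithin] with t ht i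
      have ht' : (0 : ℝ) < t := ht
      have := norm_flow_sub_le (hA i) ht'.le (p.1 i)
      rw [hp i]
      simp only [lp.coeFn_smul, Pi.smul_apply, lp.coeFn_sub, Pi.sub_apply,
        blockSemigroup_apply A hA ht'.le, norm_smul, norm_inv, Real.norm_of_nonneg ht'.le]
      rwa [inv_mul_le_iff₀ ht']
    · rw [hp i]
      exact hcoord i

end BlockDiagonal

/-! ### The two-dimensional blocks of the damped wave operator -/

section Block

/-- The operator `(y₁, y₂) ↦ (m y₂, -m y₁ - β y₂)` on `ℝ² = ℂ`. -/
def blockOp (m β : ℝ) : ℂ →L[ℝ] ℂ :=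
  (m • Complex.imCLM).smulRight 1 - (m • Complex.reCLM + β • Complex.imCLM).smulRight Complex.I

@[simp]
theorem blockOp_re (m β : ℝ) (z : ℂ) : (blockOp m β z).re = m * z.im := by
  simp [blockOp]

@[simp]
theorem blockOp_im (m β : ℝ) (z : ℂ) : (blockOp m β z).im = -m * z.re - β * z.im := by
  simp [blockOp]
  ring

theorem blockOp_dissipative (m : ℝ) {β : ℝ} (hβ : 0 ≤ β) (z : ℂ) :
    inner ℝ (blockOp m β z) z ≤ 0 := by
  simp only [Complex.inner, Complex.mul_re, Complex.conj_re, Complex.conj_im, blockOp_re,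
    blockOp_im]
  nlinarith [mul_nonneg hβ (sq_nonneg z.im)]

/-- The solution of `d'' + β d' + m² d = 0` with `d(0) = 0`, `d'(0) = 1`. -/
def position (m β s : ℝ) : ℝ := (flow (blockOp m β) s Complex.I).re / m

/-- The derivative of `position`. -/
def velocity (m β s : ℝ) : ℝ := (flow (blockOp m β) s Complex.I).im

theorem hasDerivAt_position {m : ℝ} (hm : 0 < m) (β s : ℝ) :
    HasDerivAt (position m β) (velocity m β s) s := by
  have h := ((Complex.reCLM.hasFDerivAt.comp_hasDerivAt s
    (hasDerivAt_flow_left (blockOp m β) Complex.I s)).div_const m)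
  refine h.congr_deriv ?_
  simp [velocity, hm.ne']

theorem hasDerivAt_velocity (m β s : ℝ) :
    HasDerivAt (velocity m β) (-m ^ 2 * position m β s - β * velocity m β s) s := by
  have h := Complex.imCLM.hasFDerivAt.comp_hasDerivAt s
    (hasDerivAt_flow_left (blockOp m β) Complex.I s)
  refine h.congr_deriv ?_
  simp only [Complex.imCLM_apply, blockOp_im, velocity, position]
  field_simp

@[simp]
theorem position_zero (m β : ℝ) : position m β 0 = 0 := by
  simp [position, flow_zero]

@[simp]
theorem velocity_zero (m β : ℝ) : velocity m β 0 = 1 := by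
  simp [velocity, flow_zero]

/-- This is Cayley–Hamilton for the block: its exponential is a combination of the identity and the
block itself. -/
theorem flow_I {m : ℝ} (hm : 0 < m) (β s : ℝ) :
    flow (blockOp m β) s Complex.I = (velocity m β s + β * position m β s) • Complex.I +
      position m β s • blockOp m β Complex.I := by
  apply Complex.ext <;> simp [velocity, position]
  · field_simp
  · ring

/-- Comes from `A I = m • 1 - β • I` and the fact that the flow commutes with `A`. It exhibits
`velocity + β * position` as a matrix entry of a contraction, so that its bound does not involve the
possibly huge `β`. -/
theorem flow_one_re {m : ℝ} (hm : 0 < m) (β s : ℝ) :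
    (flow (blockOp m β) s 1).re = velocity m β s + β * position m β s := by
  have h1 : blockOp m β Complex.I = m • (1 : ℂ) - β • Complex.I := by
    apply Complex.ext <;> simp
  have h := congrArg Complex.re (flow_comm (blockOp m β) Complex.I s)
  rw [h1, map_sub, map_smul, map_smul, blockOp_re] at h
  simp only [Complex.sub_re, Complex.real_smul, Complex.re_ofReal_mul] at h
  simp only [velocity, position]
  field_simp
  linarith

theorem abs_velocity_le {β : ℝ} (m : ℝ) (hβ : 0 ≤ β) {s : ℝ} (hs : 0 ≤ s) :
    |velocity m β s| ≤ 1 :=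
  (Complex.abs_im_le_norm _).trans
    ((norm_flow_le (blockOp_dissipative m hβ) hs _).trans (by simp))

theorem abs_velocity_add_le {m β : ℝ} (hm : 0 < m) (hβ : 0 ≤ β) {s : ℝ} (hs : 0 ≤ s) :
    |velocity m β s + β * position m β s| ≤ 1 := by
  rw [← flow_one_re hm]
  exact (Complex.abs_re_le_norm _).trans
    ((norm_flow_le (blockOp_dissipative m hβ) hs _).trans (by simp))

theorem abs_position_le {m β : ℝ} (hm : 0 < m) (hβ : 0 ≤ β) {s : ℝ} (hs : 0 ≤ s) :
    |position m β s| ≤ s := by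
  have := norm_image_sub_le_of_norm_deriv_le_segment' (f := position m β) (a := 0) (b := s)
    (C := 1) (fun r _ => (hasDerivAt_position hm β r).hasDerivWithinAt)
    (fun r hr => abs_velocity_le m hβ hr.1) s (right_mem_Icc.2 hs)
  simpa using this

/-- The product `exp (-l s) * q s` has zero derivative, hence is constant. -/
theorem eq_exp_of_hasDerivAt {q : ℝ → ℂ} {l : ℂ} (hq : ∀ s, HasDerivAt q (l * q s) s)
    (h0 : q 0 = 1) (s : ℝ) : q s = Complex.exp (l * s) := by
  have he : ∀ r : ℝ, HasDerivAt (fun r : ℝ => Complex.exp (-(l * r)))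
      (Complex.exp (-(l * r)) * -l) r := fun r => by
    have h1 : HasDerivAt (fun r : ℝ => -(l * (r : ℂ))) (-l) r := by
      exact (((Complex.ofRealCLM.hasDerivAt (x := r)).const_mul l).neg).congr_deriv (by simp)
    exact h1.cexp
  have hd : ∀ r : ℝ, HasDerivAt (fun r : ℝ => Complex.exp (-(l * r)) * q r) 0 r := fun r =>
    ((he r).mul (hq r)).congr_deriv (by ring)
  have hc := is_const_of_deriv_eq_zero (fun r => (hd r).differentiableAt)
    (fun r => (hd r).deriv) s 0
  simp only [Complex.ofReal_zero, mul_zero, neg_zero, Complex.exp_zero, h0, mul_one] at hc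
  rw [Complex.exp_neg] at hc
  field_simp at hc
  exact hc

/-- The factorisation of the oscillator equation along the roots `l`, `l'` of its
characteristic polynomial. -/
theorem velocity_sub_mul_position {m β : ℝ} (hm : 0 < m) {l l' : ℂ} (hsum : l + l' = -β)
    (hprod : l * l' = (m : ℂ) ^ 2) (s : ℝ) :
    (velocity m β s : ℂ) - l' * position m β s = Complex.exp (l * s) := by
  refine eq_exp_of_hasDerivAt (q := fun s => (velocity m β s : ℂ) - l' * position m β s)
    (fun r => ?_) (by simp) s
  have h := (hasDerivAt_velocity m β r).ofReal_comp.sub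
    ((hasDerivAt_position hm β r).ofReal_comp.const_mul l')
  refine h.congr_deriv ?_
  push_cast
  linear_combination (position m β r : ℂ) * hprod - (velocity m β r : ℂ) * hsum

end Block

/-! ### The scalar control -/

section Control

theorem bump_eq (t s : ℝ) : bump t s = 30 * (s ^ 2 * (t - s) ^ 2) / t ^ 5 := by
  have h : ∫ r in (0 : ℝ)..t, r ^ 2 * (t - r) ^ 2 = t ^ 5 / 30 := by
    have hd : ∀ r ∈ uIcc 0 t, HasDerivAt
        (fun r : ℝ => t ^ 2 * r ^ 3 / 3 - t * r ^ 4 / 2 + r ^ 5 / 5) (r ^ 2 * (t - r) ^ 2) r := by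
      intro r _
      have := (((hasDerivAt_pow 3 r).const_mul (t ^ 2)).div_const 3).sub
        (((hasDerivAt_pow 4 r).const_mul t).div_const 2) |>.add ((hasDerivAt_pow 5 r).div_const 5)
      refine this.congr_deriv ?_
      push_cast
      ring
    rw [intervalIntegral.integral_eq_sub_of_hasDerivAt hd
      (Continuous.intervalIntegrable (by fun_prop) _ _)]
    ring
  rw [bump, h, div_div_eq_mul_div]
  ring

/-- The derivative of `bump t`. -/
def bumpDeriv (t s : ℝ) : ℝ := 60 * (s * (t - s) * (t - 2 * s)) / t ^ 5

/-- The primitive of `bump t` that vanishes at `0`. -/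
def bumpPrim (t s : ℝ) : ℝ := (10 * t ^ 2 * s ^ 3 - 15 * t * s ^ 4 + 6 * s ^ 5) / t ^ 5

theorem hasDerivAt_bump (t s : ℝ) : HasDerivAt (bump t) (bumpDeriv t s) s := by
  have h1 : HasDerivAt (fun r : ℝ => 30 * (r ^ 2 * (t - r) ^ 2) / t ^ 5)
      (30 * (2 * s * (t - s) ^ 2 + s ^ 2 * (2 * (t - s) * -1)) / t ^ 5) s := by
    have := (((hasDerivAt_pow 2 s).mul (((hasDerivAt_id s).const_sub t).pow 2)).const_mul
      30).div_const (t ^ 5)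
    refine this.congr_deriv ?_
    simp
  rw [funext (bump_eq t)]
  refine h1.congr_deriv ?_
  rw [bumpDeriv]
  ring

theorem hasDerivAt_bumpPrim (t s : ℝ) : HasDerivAt (bumpPrim t) (bump t s) s := by
  have := ((((hasDerivAt_pow 3 s).const_mul (10 * t ^ 2)).sub
    ((hasDerivAt_pow 4 s).const_mul (15 * t))).add ((hasDerivAt_pow 5 s).const_mul 6)).div_const
      (t ^ 5)
  refine this.congr_deriv ?_
  rw [bump_eq]
  push_cast
  ring

/-- The factor by which the control multiplies the coefficient of the initial velocity. -/
def controlCoeff (m β t s : ℝ) : ℝ :=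
  -((velocity m β s + β * position m β s) * bump t s) -
    (velocity m β s * bump t s + position m β s * bumpDeriv t s)

theorem continuous_controlCoeff {m : ℝ} (hm : 0 < m) (β t : ℝ) :
    Continuous (controlCoeff m β t) := by
  have h1 : Continuous (position m β) :=
    continuous_iff_continuousAt.2 fun s => (hasDerivAt_position hm β s).continuousAt
  have h2 : Continuous (velocity m β) :=
    continuous_iff_continuousAt.2 fun s => (hasDerivAt_velocity m β s).continuousAt
  have h3 : Continuous (bump t) :=
    continuous_iff_continuousAt.2 fun s => (hasDerivAt_bump t s).continuousAt
  have h4 : Continuous (bumpDeriv t) := by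
    unfold bumpDeriv
    fun_prop
  unfold controlCoeff
  fun_prop

theorem abs_controlCoeff_le {m β : ℝ} (hm : 0 < m) (hβ : 0 ≤ β) {t s : ℝ} (ht : 0 < t)
    (hs : s ∈ Icc 0 t) : |controlCoeff m β t s| ≤ 20 / t := by
  obtain ⟨hs0, hst⟩ := hs
  have hq : s * (t - s) ≤ t ^ 2 / 4 := by nlinarith [sq_nonneg (t - 2 * s)]
  have hq0 : 0 ≤ s * (t - s) := mul_nonneg hs0 (by linarith)
  have hb : |bump t s| ≤ 2 / t := by
    rw [bump_eq, ← mul_pow, abs_of_nonneg (by positivity), div_le_div_iff₀ (by positivity) ht]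
    have : (s * (t - s)) ^ 2 ≤ (t ^ 2 / 4) ^ 2 := by gcongr
    have h5 : 0 < t ^ 5 := by positivity
    nlinarith [mul_le_mul_of_nonneg_right this ht.le]
  have hb' : |bumpDeriv t s| ≤ 15 / t ^ 2 := by
    have h3 : |t - 2 * s| ≤ t := abs_le.2 ⟨by linarith, by linarith⟩
    rw [bumpDeriv, abs_div, abs_mul, abs_mul, abs_of_nonneg hq0, abs_of_pos (by positivity : 0 < t ^ 5),
      abs_of_pos (by norm_num : (0 : ℝ) < 60), div_le_div_iff₀ (by positivity) (by positivity)]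
    have h4 : s * (t - s) * |t - 2 * s| ≤ t ^ 2 / 4 * t := by gcongr
    nlinarith [mul_le_mul_of_nonneg_right h4 (sq_nonneg t)]
  have h1 := abs_velocity_le m hβ hs0
  have h2 := abs_velocity_add_le hm hβ hs0
  have h3 := abs_position_le hm hβ hs0
  calc |controlCoeff m β t s|
      ≤ |velocity m β s + β * position m β s| * |bump t s| +
        (|velocity m β s| * |bump t s| + |position m β s| * |bumpDeriv t s|) := by
        rw [controlCoeff, ← abs_mul, ← abs_mul, ← abs_mul]
        refine (abs_sub _ _).trans ?_
        rw [abs_neg]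
        gcongr
        exact abs_add_le _ _
    _ ≤ 1 * (2 / t) + (1 * (2 / t) + t * (15 / t ^ 2)) := by
        gcongr
        exact h3.trans hst
    -- `19 = 2 + 2 + 15`; it is rounded up to `20`.
    _ = 19 / t := by field_simp; norm_num
    _ ≤ 20 / t := by gcongr; norm_num

/-- The integrand has the explicit primitive `-Φ(r) M(t) I - φ(r) d(r) M(t-r) I`, where `Φ =
bumpPrim t` rises from `0` to `1`. The second term vanishes at both ends, since `d(0) = 0` and `φ(t)
= 0`. -/
theorem integral_flow_controlCoeff {m : ℝ} (hm : 0 < m) (β : ℝ) {t : ℝ} (ht : 0 < t) :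
    ∫ r in (0 : ℝ)..t, flow (blockOp m β) (t - r) (controlCoeff m β t r • Complex.I) =
      -flow (blockOp m β) t Complex.I := by
  set M := flow (blockOp m β) with hM
  have hd : ∀ r : ℝ, HasDerivAt (fun r => -bumpPrim t r • M t Complex.I -
      (bump t r * position m β r) • M (t - r) Complex.I)
      (M (t - r) (controlCoeff m β t r • Complex.I)) r := by
    intro r
    have hflow : HasDerivAt (fun r => M (t - r) Complex.I)
        (-M (t - r) (blockOp m β Complex.I)) r := by
      have := (hasDerivAt_flow (blockOp m β) Complex.I (t - r)).scomp r
        ((hasDerivAt_id r).const_sub t)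
      simpa [Function.comp_def] using this
    have h := ((hasDerivAt_bumpPrim t r).neg.smul_const (M t Complex.I)).sub
      (((hasDerivAt_bump t r).mul (hasDerivAt_position hm β r)).smul hflow)
    refine h.congr_deriv ?_
    -- Writing `M(t) = M(t-r) M(r)` and expanding `M(r) I` makes the terms in `M(t-r) A I` cancel.
    have hsplit : M t Complex.I = (velocity m β r + β * position m β r) • M (t - r) Complex.I +
        position m β r • M (t - r) (blockOp m β Complex.I) := by
      rw [← map_smul, ← map_smul, ← map_add, ← flow_I hm, hM, ← ContinuousLinearMap.comp_apply,
        ← flow_add, sub_add_cancel]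
    rw [hsplit, map_smul, controlCoeff, Pi.mul_apply]
    module
  have hcont : Continuous fun r => M (t - r) (controlCoeff m β t r • Complex.I) := by
    have h1 : Continuous fun r => M r Complex.I :=
      continuous_iff_continuousAt.2 fun s => (hasDerivAt_flow _ Complex.I s).continuousAt
    simp only [map_smul]
    exact (continuous_controlCoeff hm β t).smul (h1.comp (continuous_const.sub continuous_id))
  rw [intervalIntegral.integral_eq_sub_of_hasDerivAt (fun r _ => hd r)
    (hcont.intervalIntegrable _ _)]
  have h1 : bumpPrim t t = 1 := by
    rw [bumpPrim, div_eq_one_iff_eq (by positivity)]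
    ring
  have h0 : bumpPrim t 0 = 0 := by simp [bumpPrim]
  have h2 : bump t t = 0 := by simp [bump_eq]
  simp [h1, h0, h2]

/-- Solving `e^{λ^± s} = d' - λ^∓ d` for the two quotients gives `d' + β d` in `v₀` and `d` in `v₁`.
Only the square of the complex root `w` and `w ≠ 0` matter, so real and complex `λ^±` are treated
together. -/
theorem coeffZero_add_deriv_coeffOne {α ρ μ : ℝ} (hμ : 0 < μ)
    (hdisc : ρ ^ 2 * μ ^ (2 * α) - 4 * μ ≠ 0) (t s : ℝ) :
    coeffZero α ρ μ t s + deriv (coeffOne α ρ μ t) s =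
      (controlCoeff (√μ) (ρ * μ ^ α) t s : ℂ) := by
  have hm : 0 < √μ := Real.sqrt_pos.2 hμ
  set β := ρ * μ ^ α with hβ
  set w : ℂ := ((ρ ^ 2 * μ ^ (2 * α) - 4 * μ : ℝ) : ℂ) ^ (1 / 2 : ℂ) with hw
  have hww : w ^ 2 = (β : ℂ) ^ 2 - 4 * μ := by
    have h1 : w ^ 2 = ((ρ ^ 2 * μ ^ (2 * α) - 4 * μ : ℝ) : ℂ) := by
      rw [hw, ← Complex.cpow_nat_mul]
      norm_num
    have h2 : μ ^ (2 * α) = (μ ^ α) ^ 2 := by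
      rw [mul_comm, Real.rpow_mul hμ.le]
      norm_num
    rw [h1, h2, hβ]
    push_cast
    ring
  have hw0 : w ≠ 0 := by
    rw [hw]
    simp only [ne_eq, Complex.cpow_eq_zero_iff, Complex.ofReal_eq_zero, hdisc, false_and,
      not_false_eq_true]
  have hP : rootP α ρ μ = (-β + w) / 2 := rfl
  have hN : rootM α ρ μ = (-β - w) / 2 := rfl
  have hsum : rootP α ρ μ + rootM α ρ μ = -β := by rw [hP, hN]; ring
  have hsq : ((√μ : ℝ) : ℂ) ^ 2 = μ := by
    rw [← Complex.ofReal_pow, Real.sq_sqrt hμ.le]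
  have hprod : rootP α ρ μ * rootM α ρ μ = ((√μ : ℝ) : ℂ) ^ 2 := by
    rw [hP, hN, hsq]
    linear_combination (-1 / 4 : ℂ) * hww
  have hne : rootM α ρ μ - rootP α ρ μ ≠ 0 := by
    have : rootM α ρ μ - rootP α ρ μ = -w := by rw [hP, hN]; ring
    rw [this]
    exact neg_ne_zero.2 hw0
  have hexpP := velocity_sub_mul_position hm hsum hprod
  have hexpM := velocity_sub_mul_position hm ((add_comm _ _).trans hsum)
    ((mul_comm _ _).trans hprod)
  have hzero : coeffZero α ρ μ t s =
      -(((velocity (√μ) β s + β * position (√μ) β s) * bump t s : ℝ) : ℂ) := by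
    rw [coeffZero, ← hexpP, ← hexpM]
    push_cast
    rw [neg_mul, neg_inj]
    congr 1
    rw [div_eq_iff hne]
    linear_combination ((rootP α ρ μ - rootM α ρ μ) * position (√μ) β s) * hsum
  have hone : coeffOne α ρ μ t = fun r => ((-(position (√μ) β r * bump t r) : ℝ) : ℂ) := by
    funext r
    rw [coeffOne, ← hexpP, ← hexpM]
    push_cast
    rw [neg_mul, neg_inj]
    congr 1
    rw [div_eq_iff hne]
    ring
  have hder : HasDerivAt (fun r => ((-(position (√μ) β r * bump t r) : ℝ) : ℂ)) _ s :=
    (((hasDerivAt_position hm β s).mul (hasDerivAt_bump t s)).neg).ofReal_comp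
  rw [hzero, hone, HasDerivAt.deriv hder, controlCoeff]
  push_cast
  ring

end Control

/-! ### The spectral decomposition of `Λ` -/

/-- The rank-one terms are compact and their series converges absolutely in operator norm, while
compact operators are closed under norm limits. -/
theorem IsTraceClass.isCompactOperator {E : Type*} [NormedAddCommGroup E] [InnerProductSpace ℝ E]
    [CompleteSpace E] {R : E →L[ℝ] E} (h : IsTraceClass R) : IsCompactOperator R := by
  obtain ⟨x, y, hs, hR⟩ := h
  set F : ℕ → E →L[ℝ] E := fun n => (innerSL ℝ (x n)).smulRight (y n) with hF
  have hsum : Summable F := by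
    refine Summable.of_norm (hs.congr fun n => ?_)
    rw [hF, ContinuousLinearMap.norm_smulRight_apply, innerSL_apply_norm]
  have hRF : HasSum F R := by
    convert hsum.hasSum
    ext z
    refine (hR z).unique ?_
    exact hsum.hasSum.mapL (ContinuousLinearMap.apply ℝ E z)
  have hcomp : ∀ n, F n ∈ compactOperator (RingHom.id ℝ) E E := fun n => by
    have h1 : IsCompactOperator (innerSL ℝ (x n)) :=
      (isCompactOperator_id (E := ℝ)).comp_clm (innerSL ℝ (x n))
    exact h1.clm_comp (ContinuousLinearMap.toSpanSingleton ℝ (y n))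
  exact isCompactOperator_of_tendsto hRF (Eventually.of_forall fun s => Submodule.sum_mem _
    fun n _ => hcomp n)

universe u

variable {U : Type u} [NormedAddCommGroup U] [InnerProductSpace ℝ U] [CompleteSpace U]

/-- A Hilbert basis of `U` consisting of eigenvectors of `Λ`. -/
structure EigenBasis (Λ : PosOp U) (ι : Type u) where
  basis : HilbertBasis ι ℝ U
  eig : ι → ℝ
  eig_pos : ∀ i, 0 < eig i
  inv_basis : ∀ i, Λ.inv (basis i) = (eig i)⁻¹ • basis i

/-- Hilbert bases of all eigenspaces of `Λ.inv` are glued together; the spectral theorem makes the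
union complete. Each basis vector `v` has eigenvalue `⟪Λ.inv v, v⟫`, which definiteness makes
strictly positive. -/
theorem exists_eigenBasis (Λ : PosOp U) (hΛ : IsCompactOperator Λ.inv) :
    ∃ ι : Type u, Nonempty (EigenBasis Λ ι) := by
  have hsymm : Λ.inv.IsSymmetric := fun x y => Λ.inv_symm x y
  have hclosed : ∀ ν : ℝ, CompleteSpace (Module.End.eigenspace (Λ.inv : Module.End ℝ U) ν) := by
    intro ν
    have : IsClosed (Module.End.eigenspace (Λ.inv : Module.End ℝ U) ν : Set U) := by
      have h1 : (Module.End.eigenspace (Λ.inv : Module.End ℝ U) ν : Set U) =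
          {x | Λ.inv x = ν • x} := by
        ext x
        simp
      rw [h1]
      exact isClosed_eq Λ.inv.continuous (continuous_const_smul ν)
    exact this.completeSpace_coe
  choose w b hb using fun ν : ℝ =>
    exists_hilbertBasis ℝ (Module.End.eigenspace (Λ.inv : Module.End ℝ U) ν)
  set v : (Σ ν : ℝ, w ν) → U := fun p => (b p.1 p.2 : U) with hv
  have hortho : Orthonormal ℝ v :=
    hsymm.orthogonalFamily_eigenspaces.orthonormal_sigma_orthonormal fun ν => (b ν).orthonormal
  have hbot : (Submodule.span ℝ (range v))ᗮ = ⊥ := by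
    rw [eq_bot_iff, ← ContinuousLinearMap.orthogonalComplement_iSup_eigenspaces_eq_bot hΛ hsymm,
      ← Submodule.iInf_orthogonal]
    intro x hx
    rw [Submodule.mem_iInf]
    intro ν
    rw [Submodule.mem_orthogonal']
    intro y hy
    have hsum := (((b ν).hasSum_repr ⟨y, hy⟩).mapL (Submodule.subtypeL _)).mapL (innerSL ℝ x)
    refine hsum.unique ?_
    convert hasSum_zero with i
    have hi : inner ℝ x (v ⟨ν, i⟩) = 0 :=
      (Submodule.mem_orthogonal' _ x).1 hx _ (Submodule.subset_span (mem_range_self _))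
    simp only [map_smul, Submodule.subtypeL_apply, innerSL_apply_apply]
    rw [hi, smul_zero]
  have hinv : ∀ p, Λ.inv (v p) = p.1 • v p := fun p =>
    Module.End.mem_eigenspace_iff.1 (b p.1 p.2).2
  have hnorm : ∀ p, inner ℝ (v p) (v p) = 1 := fun p => by
    rw [real_inner_self_eq_norm_sq, hortho.1 p, one_pow]
  refine ⟨_, ⟨⟨HilbertBasis.mkOfOrthogonalEqBot hortho hbot, fun p => p.1⁻¹, fun p => ?_,
    fun p => ?_⟩⟩⟩
  · rw [inv_pos]
    have h1 : inner ℝ (Λ.inv (v p)) (v p) = p.1 := by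
      rw [hinv, real_inner_smul_left, hnorm, mul_one]
    refine lt_of_le_of_ne (h1 ▸ Λ.inv_nonneg (v p)) fun h0 => ?_
    have := Λ.inv_definite (v p) (h1.trans h0.symm)
    have h2 := hnorm p
    rw [this, inner_zero_left] at h2
    exact zero_ne_one h2
  · rw [HilbertBasis.coe_mkOfOrthogonalEqBot, inv_inv]
    exact hinv p

/-! ### The space `V'` in coordinates -/

theorem inner_incl (Λ : PosOp U) (x y : U) :
    inner ℝ (incl Λ x) (incl Λ y) = inner ℝ (Λ.inv x) y :=
  UniformSpace.Completion.inner_coe (𝕜 := ℝ) (PreVDual.of Λ x) (PreVDual.of Λ y)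

theorem continuous_incl (Λ : PosOp U) : Continuous (incl Λ) := by
  refine AddMonoidHomClass.continuous_of_bound (incl Λ) (√‖Λ.inv‖) fun x => ?_
  rw [← Real.sqrt_sq (norm_nonneg x), ← Real.sqrt_mul (norm_nonneg _)]
  refine Real.le_sqrt_of_sq_le ?_
  rw [← real_inner_self_eq_norm_sq, inner_incl]
  calc inner ℝ (Λ.inv x) x ≤ ‖Λ.inv x‖ * ‖x‖ := real_inner_le_norm _ _
    _ ≤ ‖Λ.inv‖ * ‖x‖ * ‖x‖ := by gcongr; exact Λ.inv.le_opNorm x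
    _ = ‖Λ.inv‖ * ‖x‖ ^ 2 := by ring

theorem denseRange_incl (Λ : PosOp U) : DenseRange (incl Λ) :=
  UniformSpace.Completion.denseRange_coe (α := PreVDual Λ)

namespace EigenBasis

variable {Λ : PosOp U} {ι : Type u} (B : EigenBasis Λ ι)

theorem sqrt_pos (i : ι) : 0 < √(B.eig i) := Real.sqrt_pos.2 (B.eig_pos i)

theorem mem_domain (i : ι) : B.basis i ∈ Λ.op.domain := by
  have h := Λ.op.domain.smul_mem (B.eig i) (Λ.inv_mem (B.basis i))
  rwa [B.inv_basis, smul_inv_smul₀ (B.eig_pos i).ne'] at h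

theorem op_basis (i : ι) : Λ.op ⟨B.basis i, B.mem_domain i⟩ = B.eig i • B.basis i := by
  have h1 : (⟨B.basis i, B.mem_domain i⟩ : Λ.op.domain) =
      B.eig i • ⟨Λ.inv (B.basis i), Λ.inv_mem _⟩ := by
    apply Subtype.ext
    simp [B.inv_basis, smul_inv_smul₀ (B.eig_pos i).ne']
  rw [h1, LinearPMap.map_smul, Λ.op_inv]

/-- The eigenvectors of `Λ`, normalised in `V'`. -/
def dualVec (i : ι) : VDual Λ := √(B.eig i) • incl Λ (B.basis i)

theorem inner_dualVec_incl (i : ι) (x : U) :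
    inner ℝ (B.dualVec i) (incl Λ x) = (√(B.eig i))⁻¹ * inner ℝ (B.basis i) x := by
  rw [dualVec, real_inner_smul_left, inner_incl, B.inv_basis, real_inner_smul_left, ← mul_assoc]
  congr 1
  have := B.sqrt_pos i
  nth_rw 2 [← Real.mul_self_sqrt (B.eig_pos i).le]
  field_simp

theorem orthonormal_dualVec : Orthonormal ℝ B.dualVec := by
  classical
  rw [orthonormal_iff_ite]
  intro i j
  have h := orthonormal_iff_ite.1 B.basis.orthonormal i j
  have := B.sqrt_pos i
  rw [show B.dualVec j = √(B.eig j) • incl Λ (B.basis j) from rfl, real_inner_smul_right,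
    B.inner_dualVec_incl, h]
  split_ifs with hij
  · subst hij
    field_simp
  · simp

/-- Orthogonality to the images of the basis extends to the image of `U` by continuity of `incl`,
then to `V'` by density. -/
theorem span_dualVec_orthogonal : (Submodule.span ℝ (range B.dualVec))ᗮ = ⊥ := by
  rw [eq_bot_iff]
  intro z hz
  have h1 : ∀ i, inner ℝ (incl Λ (B.basis i)) z = 0 := fun i => by
    have h := (Submodule.mem_orthogonal _ z).1 hz _ (Submodule.subset_span (mem_range_self i))
    rw [dualVec, real_inner_smul_left] at h
    exact (mul_eq_zero.1 h).resolve_left (B.sqrt_pos i).ne'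
  have h2 : ∀ x, inner ℝ (incl Λ x) z = 0 := by
    intro x
    have hx := ((B.basis.hasSum_repr x).map (incl Λ) (continuous_incl Λ)).mapL (innerSL ℝ z)
    refine real_inner_comm z (incl Λ x) ▸ hx.unique ?_
    convert hasSum_zero with i
    have hi := h1 i
    rw [real_inner_comm] at hi
    simp [hi]
  have h3 : ∀ y, inner ℝ y z = (0 : ℝ) := fun y =>
    (denseRange_incl Λ).induction_on (p := fun y => inner ℝ y z = (0 : ℝ)) y
      (isClosed_eq (by fun_prop) continuous_const) h2
  exact inner_self_eq_zero.1 (h3 z)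

/-- The Hilbert basis of `V'` consisting of eigenvectors of `Λ`. -/
def dualBasis : HilbertBasis ι ℝ (VDual Λ) :=
  HilbertBasis.mkOfOrthogonalEqBot B.orthonormal_dualVec B.span_dualVec_orthogonal

theorem dualBasis_apply (i : ι) : B.dualBasis i = √(B.eig i) • incl Λ (B.basis i) := by
  rw [dualBasis, HilbertBasis.coe_mkOfOrthogonalEqBot, dualVec]

theorem dualBasis_repr_incl (x : U) (i : ι) :
    B.dualBasis.repr (incl Λ x) i = (√(B.eig i))⁻¹ * B.basis.repr x i := by
  rw [HilbertBasis.repr_apply_apply, HilbertBasis.repr_apply_apply, dualBasis_apply,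
    ← B.inner_dualVec_incl, dualVec]

theorem eq_of_repr_eq {x y : VDual Λ} (h : ∀ i, B.dualBasis.repr x i = B.dualBasis.repr y i) :
    x = y :=
  B.dualBasis.repr.injective (lp.ext (funext h))

theorem repr_op (x : Λ.op.domain) (i : ι) :
    B.basis.repr (Λ.op x) i = B.eig i * B.basis.repr (x : U) i := by
  have h := Λ.inv_symm (B.basis i) (Λ.op x)
  rw [Λ.inv_op, B.inv_basis, real_inner_smul_left] at h
  rw [HilbertBasis.repr_apply_apply, HilbertBasis.repr_apply_apply, ← h,
    mul_inv_cancel_left₀ (B.eig_pos i).ne']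

/-- The coordinate condition is closed and holds on the graph of `Λ`. Conversely, partial sums of
the two expansions lie in that graph, because finite combinations of basis vectors are in the
domain. -/
theorem mem_extGraph_iff (p : VDual Λ × VDual Λ) : p ∈ extGraph Λ ↔
    ∀ i, B.dualBasis.repr p.2 i = B.eig i * B.dualBasis.repr p.1 i := by
  constructor
  · intro hp
    have hclosed : IsClosed {p : VDual Λ × VDual Λ |
        ∀ i, B.dualBasis.repr p.2 i = B.eig i * B.dualBasis.repr p.1 i} := by
      simp only [ofPred_forall, HilbertBasis.repr_apply_apply]
      exact isClosed_iInter fun i => isClosed_eq (by fun_prop) (by fun_prop)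
    refine closure_minimal ?_ hclosed hp
    rintro _ ⟨x, rfl⟩ i
    simp only [dualBasis_repr_incl, repr_op]
    ring
  · intro hp
    have h1 := B.dualBasis.hasSum_repr p.1
    have h2 := B.dualBasis.hasSum_repr p.2
    refine mem_closure_of_tendsto (h1.prodMk h2) (Eventually.of_forall fun s => ?_)
    refine ⟨∑ i ∈ s, (B.dualBasis.repr p.1 i * √(B.eig i)) • ⟨B.basis i, B.mem_domain i⟩, ?_⟩
    have hop : ∀ y : Λ.op.domain, Λ.op y = Λ.op.toFun y := fun y => rfl
    ext1
    · simp [dualBasis_apply, smul_smul, Prod.fst_sum]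
    · simp only [hop, map_sum, map_smul, Prod.snd_sum]
      refine Finset.sum_congr rfl fun i _ => ?_
      rw [← hop, op_basis, dualBasis_apply, hp, map_smul, smul_smul, smul_smul]
      congr 1
      ring

/-- An eigenvector with eigenvalue `μ` has nonzero coordinates only where `B.eig i = μ`. Thus
conditions quantified over all eigenvectors reduce to conditions on the basis. -/
theorem inner_eq_of_repr_eq {g : ℝ → ℝ} {x y : VDual Λ}
    (h : ∀ i, B.dualBasis.repr y i = g (B.eig i) * B.dualBasis.repr x i) {e : VDual Λ} {μ : ℝ}
    (he : (e, μ • e) ∈ extGraph Λ) : inner ℝ y e = g μ * inner ℝ x e := by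
  have hy := B.dualBasis.hasSum_inner_mul_inner y e
  have hx := (B.dualBasis.hasSum_inner_mul_inner x e).mul_left (g μ)
  have key : ∀ i, inner ℝ y (B.dualBasis i) * inner ℝ (B.dualBasis i) e =
      g μ * (inner ℝ x (B.dualBasis i) * inner ℝ (B.dualBasis i) e) := by
    intro i
    have hei := (B.mem_extGraph_iff _).1 he i
    simp only [map_smul, lp.coeFn_smul, Pi.smul_apply, smul_eq_mul] at hei
    have hi := h i
    rw [HilbertBasis.repr_apply_apply] at hei
    rw [HilbertBasis.repr_apply_apply, HilbertBasis.repr_apply_apply] at hi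
    rw [real_inner_comm, hi, real_inner_comm x]
    rcases mul_eq_mul_right_iff.1 hei with hμ | h0
    · rw [hμ, mul_assoc]
    · rw [h0]
      ring
  rw [funext key] at hy
  exact hy.unique hx

theorem mem_powGraph_iff (s : ℝ) (p : VDual Λ × VDual Λ) : p ∈ powGraph Λ s ↔
    ∀ i, B.dualBasis.repr p.2 i = B.eig i ^ s * B.dualBasis.repr p.1 i := by
  classical
  constructor
  · intro hp i
    have h := hp (B.dualBasis i) (B.eig i) ((B.mem_extGraph_iff _).2 fun j => by
      rcases eq_or_ne j i with rfl | hij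
      · simp
      · simp [B.dualBasis.repr_self, hij])
    rwa [real_inner_comm, real_inner_comm _ p.1, ← HilbertBasis.repr_apply_apply,
      ← HilbertBasis.repr_apply_apply] at h
  · exact fun hp e μ he => B.inner_eq_of_repr_eq (g := fun μ => μ ^ s) hp he

end EigenBasis

/-! ### The damped wave operators in coordinates -/

section Coordinates

variable {ι : Type*}

theorem norm_sq_complex_mk (x y : ℝ) : ‖(⟨x, y⟩ : ℂ)‖ ^ 2 = ‖x‖ ^ 2 + ‖y‖ ^ 2 := by
  rw [Complex.sq_norm, Complex.normSq_apply, Real.norm_eq_abs, Real.norm_eq_abs, sq_abs, sq_abs]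
  ring

theorem memℓp_complex_mk (x y : lp (fun _ : ι => ℝ) 2) :
    Memℓp (fun i => (⟨x i, y i⟩ : ℂ)) 2 := by
  refine ((lp.memℓp x).norm.add (lp.memℓp y).norm).mono fun i => ?_
  exact Complex.norm_le_abs_re_add_abs_im _

/-- The identification of a product of two Hilbert spaces with a space of sequences in
`ℝ² = ℂ`. -/
def pairIso {E F : Type*} [NormedAddCommGroup E] [InnerProductSpace ℝ E] [NormedAddCommGroup F]
    [InnerProductSpace ℝ F] (b : HilbertBasis ι ℝ E) (c : HilbertBasis ι ℝ F) :
    WithLp 2 (E × F) ≃ₗᵢ[ℝ] lp (fun _ : ι => ℂ) 2 :=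
  LinearIsometryEquiv.ofSurjective
    { toFun := fun p => ⟨fun i => ⟨b.repr p.fst i, c.repr p.snd i⟩, memℓp_complex_mk _ _⟩
      map_add' := fun p q => by
        ext i
        apply Complex.ext <;> simp <;> rfl
      map_smul' := fun r p => by
        ext i
        apply Complex.ext <;> simp
      norm_map' := fun p => by
        refine (sq_eq_sq₀ (norm_nonneg _) (norm_nonneg _)).1 ?_
        rw [WithLp.prod_norm_sq_eq_of_L2, ← b.repr.norm_map p.fst, ← c.repr.norm_map p.snd,
          norm_sq_lp, norm_sq_lp, norm_sq_lp,
          ← (summable_sq_norm_lp _).tsum_add (summable_sq_norm_lp _)]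
        exact tsum_congr fun i => norm_sq_complex_mk _ _ }
    fun z => by
      have hre : Memℓp (fun i => (z i).re) 2 :=
        (lp.memℓp z).mono' fun i => Complex.abs_re_le_norm _
      have him : Memℓp (fun i => (z i).im) 2 :=
        (lp.memℓp z).mono' fun i => Complex.abs_im_le_norm _
      refine ⟨WithLp.toLp 2 (b.repr.symm ⟨_, hre⟩, c.repr.symm ⟨_, him⟩), ?_⟩
      ext i
      apply Complex.ext <;> simp

theorem pairIso_apply {E F : Type*} [NormedAddCommGroup E] [InnerProductSpace ℝ E]
    [NormedAddCommGroup F] [InnerProductSpace ℝ F] (b : HilbertBasis ι ℝ E)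
    (c : HilbertBasis ι ℝ F) (p : WithLp 2 (E × F)) (i : ι) :
    pairIso b c p i = ⟨b.repr p.fst i, c.repr p.snd i⟩ := rfl

/-- The damped wave operator in coordinates, with eigenvalues `μ i`. -/
def coordGraph (μ : ι → ℝ) (α ρ : ℝ) : Set (lp (fun _ : ι => ℂ) 2 × lp (fun _ : ι => ℂ) 2) :=
  {p | ∃ b c : lp (fun _ : ι => ℝ) 2, ∀ i, b i = √(μ i) * (p.1 i).re ∧
    c i = μ i ^ α * (p.1 i).im ∧ p.2 i = ⟨√(μ i) * (p.1 i).im, -b i - ρ * c i⟩}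

theorem sum_single_apply {G : Type*} [NormedAddCommGroup G] [DecidableEq ι]
    (s : Finset ι) (x : ι → G) (j : ι) :
    (∑ i ∈ s, lp.single 2 i (x i) : lp (fun _ : ι => G) 2) j = if j ∈ s then x j else 0 := by
  rw [lp.coeFn_sum, Finset.sum_apply]
  simp [Pi.single_apply]

/-- The graph asks both terms of the second component to be square-summable separately, whereas the
right-hand side asks this of their sum only. Finite truncations satisfy the stronger condition and
approximate every point in graph norm. -/
theorem closure_coordGraph (μ : ι → ℝ) (α ρ : ℝ) : closure (coordGraph μ α ρ) =
    {p | ∀ i, p.2 i = blockOp (√(μ i)) (ρ * μ i ^ α) (p.1 i)} := by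
  classical
  apply Subset.antisymm
  · refine closure_minimal ?_ ?_
    · rintro p ⟨b, c, h⟩ i
      obtain ⟨hb, hc, h2⟩ := h i
      rw [h2, hb, hc]
      apply Complex.ext
      · simp
      · simp
        ring
    · rw [ofPred_forall]
      have hev : ∀ i, Continuous fun x : lp (fun _ : ι => ℂ) 2 => x i := fun i =>
        (lp.evalCLM ℝ (fun _ : ι => ℂ) 2 i).continuous
      exact isClosed_iInter fun i => isClosed_eq ((hev i).comp continuous_snd)
        ((blockOp _ _).continuous.comp ((hev i).comp continuous_fst))
  · intro p hp
    refine mem_closure_of_tendsto ((lp.hasSum_single (by norm_num) p.1).prodMk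
      (lp.hasSum_single (by norm_num) p.2)) (Eventually.of_forall fun s => ?_)
    refine ⟨∑ i ∈ s, lp.single 2 i (√(μ i) * (p.1 i).re),
      ∑ i ∈ s, lp.single 2 i (μ i ^ α * (p.1 i).im), fun j => ?_⟩
    simp only [Prod.fst_sum, Prod.snd_sum, sum_single_apply]
    split_ifs
    · refine ⟨rfl, rfl, ?_⟩
      rw [hp j]
      apply Complex.ext
      · simp
      · simp
        ring
    · simp [Complex.ext_iff]

end Coordinates

namespace EigenBasis

variable {Λ : PosOp U} {ι : Type u} (B : EigenBasis Λ ι)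

theorem waveGraphT_eq (α ρ : ℝ) : waveGraphT Λ α ρ =
    {p | (pairIso B.dualBasis B.dualBasis p.1, pairIso B.dualBasis B.dualBasis p.2) ∈
      coordGraph B.eig α ρ} := by
  ext p
  simp only [waveGraphT, coordGraph, mem_ofPred_eq, B.mem_powGraph_iff, pairIso_apply,
    ← Real.sqrt_eq_rpow]
  constructor
  · rintro ⟨h1, b, c, hb, hc, h2⟩
    refine ⟨B.dualBasis.repr b, B.dualBasis.repr c, fun i => ⟨hb i, hc i, ?_⟩⟩
    rw [h1, h2, map_sub, map_neg, map_smul]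
    rfl
  · rintro ⟨b, c, h⟩
    refine ⟨fun i => congrArg Complex.re (h i).2.2, B.dualBasis.repr.symm b,
      B.dualBasis.repr.symm c, fun i => ?_, fun i => ?_, B.eq_of_repr_eq fun i => ?_⟩
    · simpa using (h i).1
    · simpa using (h i).2.1
    · simp only [map_sub, map_neg, map_smul, LinearIsometryEquiv.apply_symm_apply]
      exact congrArg Complex.im (h i).2.2

/-- Measuring the first component in the basis of `U` rather than that of `V'` multiplies its
coordinates by `√μ`. This balances the entries `1` and `-μ` of the wave operator into `√μ` and
`-√μ`, the same blocks as for `waveGraphT`. -/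
theorem waveGraph_eq (α ρ : ℝ) : waveGraph Λ α ρ =
    {p | (pairIso B.basis B.dualBasis p.1, pairIso B.basis B.dualBasis p.2) ∈
      coordGraph B.eig α ρ} := by
  have hsq : ∀ i, B.eig i * (√(B.eig i))⁻¹ = √(B.eig i) := fun i => by
    rw [← div_eq_mul_inv, Real.div_sqrt]
  ext p
  simp only [waveGraph, coordGraph, mem_ofPred_eq, B.mem_powGraph_iff, B.mem_extGraph_iff,
    pairIso_apply, dualBasis_repr_incl, ← mul_assoc, hsq]
  constructor
  · rintro ⟨h1, b, c, hb, hc, h2⟩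
    refine ⟨B.dualBasis.repr b, B.dualBasis.repr c, fun i => ⟨hb i, hc i, ?_⟩⟩
    rw [← h1, h2, dualBasis_repr_incl, mul_inv_cancel_left₀ (B.sqrt_pos i).ne',
      map_sub, map_neg, map_smul]
    rfl
  · rintro ⟨b, c, h⟩
    refine ⟨B.eq_of_repr_eq fun i => ?_, B.dualBasis.repr.symm b,
      B.dualBasis.repr.symm c, fun i => ?_, fun i => ?_, B.eq_of_repr_eq fun i => ?_⟩
    · have := congrArg Complex.re (h i).2.2
      simp only at this
      rw [dualBasis_repr_incl, this, inv_mul_cancel_left₀ (B.sqrt_pos i).ne']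
    · simpa using (h i).1
    · simpa using (h i).2.1
    · simp only [map_sub, map_neg, map_smul, LinearIsometryEquiv.apply_symm_apply]
      exact congrArg Complex.im (h i).2.2

/-! ### The control -/

theorem norm_controlCoeff_mul_le (α : ℝ) {ρ t : ℝ} (hρ : 0 < ρ) (ht : 0 < t) (a : VDual Λ)
    (s : ℝ) (i : ι) :
    ‖controlCoeff (√(B.eig i)) (ρ * B.eig i ^ α) t (projIcc 0 t ht.le s) *
      B.dualBasis.repr a i‖ ≤ ‖((20 / t) • B.dualBasis.repr a) i‖ := by
  rw [lp.coeFn_smul, Pi.smul_apply, smul_eq_mul, norm_mul, norm_mul,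
    Real.norm_of_nonneg (by positivity : 0 ≤ 20 / t)]
  gcongr
  exact abs_controlCoeff_le (B.sqrt_pos i)
    (mul_nonneg hρ.le (Real.rpow_nonneg (B.eig_pos i).le _)) ht (projIcc 0 t ht.le s).2

/-- The coordinates of the control that steers `Ga` to `0` at time `t`, continued by constants
outside `[0, t]`. -/
def controlSeq (α : ℝ) {ρ t : ℝ} (hρ : 0 < ρ) (ht : 0 < t) (a : VDual Λ) (s : ℝ) :
    lp (fun _ : ι => ℝ) 2 :=
  ⟨fun i => controlCoeff (√(B.eig i)) (ρ * B.eig i ^ α) t (projIcc 0 t ht.le s) *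
      B.dualBasis.repr a i,
    (lp.memℓp ((20 / t) • B.dualBasis.repr a)).mono' (B.norm_controlCoeff_mul_le α hρ ht a s)⟩

theorem controlSeq_apply (α : ℝ) {ρ t : ℝ} (hρ : 0 < ρ) (ht : 0 < t) (a : VDual Λ) (s : ℝ)
    (i : ι) : B.controlSeq α hρ ht a s i =
      controlCoeff (√(B.eig i)) (ρ * B.eig i ^ α) t (projIcc 0 t ht.le s) *
        B.dualBasis.repr a i := rfl

theorem norm_controlSeq_apply_le (α : ℝ) {ρ t : ℝ} (hρ : 0 < ρ) (ht : 0 < t) (a : VDual Λ)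
    (s : ℝ) (i : ι) :
    ‖B.controlSeq α hρ ht a s i‖ ≤ ‖((20 / t) • B.dualBasis.repr a) i‖ :=
  B.norm_controlCoeff_mul_le α hρ ht a s i

theorem continuous_controlSeq_apply (α : ℝ) {ρ t : ℝ} (hρ : 0 < ρ) (ht : 0 < t) (a : VDual Λ)
    (i : ι) : Continuous fun s => B.controlSeq α hρ ht a s i := by
  simp only [controlSeq_apply]
  exact ((continuous_controlCoeff (B.sqrt_pos i) _ t).comp
    (continuous_subtype_val.comp continuous_projIcc)).mul continuous_const

theorem continuous_controlSeq (α : ℝ) {ρ t : ℝ} (hρ : 0 < ρ) (ht : 0 < t) (a : VDual Λ) :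
    Continuous (B.controlSeq α hρ ht a) :=
  continuous_iff_continuousAt.2 fun s =>
    tendsto_lp_of_dominated (summable_sq_norm_lp ((20 / t) • B.dualBasis.repr a))
      (Eventually.of_forall fun r i => B.norm_controlSeq_apply_le α hρ ht a r i)
      fun i => (B.continuous_controlSeq_apply α hρ ht a i).tendsto s

/-- The control that steers `Ga` to `0` at time `t`. -/
def control (α : ℝ) {ρ t : ℝ} (hρ : 0 < ρ) (ht : 0 < t) (a : VDual Λ) (s : ℝ) : VDual Λ :=
  B.dualBasis.repr.symm (B.controlSeq α hρ ht a s)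

theorem repr_control (α : ℝ) {ρ t : ℝ} (hρ : 0 < ρ) (ht : 0 < t) (a : VDual Λ) (s : ℝ) :
    B.dualBasis.repr (B.control α hρ ht a s) = B.controlSeq α hρ ht a s := by
  simp [control]

theorem continuous_control (α : ℝ) {ρ t : ℝ} (hρ : 0 < ρ) (ht : 0 < t) (a : VDual Λ) :
    Continuous (B.control α hρ ht a) :=
  B.dualBasis.repr.symm.continuous.comp (B.continuous_controlSeq α hρ ht a)

theorem norm_control_le (α : ℝ) {ρ t : ℝ} (hρ : 0 < ρ) (ht : 0 < t) (a : VDual Λ) (s : ℝ) :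
    ‖B.control α hρ ht a s‖ ≤ 20 / t * ‖a‖ := by
  rw [control, LinearIsometryEquiv.norm_map]
  refine (lp.norm_mono (by norm_num) (B.norm_controlSeq_apply_le α hρ ht a s)).trans ?_
  rw [norm_smul, LinearIsometryEquiv.norm_map, Real.norm_of_nonneg (by positivity)]

theorem lintegral_control_le (α : ℝ) {ρ t : ℝ} (hρ : 0 < ρ) (ht : 0 < t) (a : VDual Λ) :
    ∫⁻ s in Ioc 0 t, ‖B.control α hρ ht a s‖ₑ ^ 2 ≤ ENNReal.ofReal (400 * ‖a‖ ^ 2 / t) := by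
  calc ∫⁻ s in Ioc 0 t, ‖B.control α hρ ht a s‖ₑ ^ 2
      ≤ ∫⁻ _ in Ioc 0 t, ENNReal.ofReal ((20 / t * ‖a‖) ^ 2) := by
        refine lintegral_mono fun s => ?_
        rw [← ofReal_norm, ← ENNReal.ofReal_pow (norm_nonneg _)]
        gcongr
        exact B.norm_control_le α hρ ht a s
    _ = ENNReal.ofReal (400 * ‖a‖ ^ 2 / t) := by
        rw [setLIntegral_const, Real.volume_Ioc, ← ENNReal.ofReal_mul (by positivity)]
        congr 1
        field_simp
        ring

theorem memLp_control (α : ℝ) {ρ t : ℝ} (hρ : 0 < ρ) (ht : 0 < t) (a : VDual Λ) (T : ℝ) :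
    MemLp (B.control α hρ ht a) 2 (volume.restrict (Ioc 0 T)) :=
  MemLp.of_bound (B.continuous_control α hρ ht a).aestronglyMeasurable (20 / t * ‖a‖)
    (Eventually.of_forall (B.norm_control_le α hρ ht a))

theorem isSpectralControl_control {α ρ t : ℝ} (hρ : 0 < ρ) (ht : 0 < t)
    (hρμ : ∀ (μ : ℝ) (x : Λ.op.domain), (x : U) ≠ 0 → Λ.op x = μ • (x : U) →
      ρ ^ 2 ≠ 4 * μ ^ (1 - 2 * α)) (a : VDual Λ) :
    IsSpectralControl Λ α ρ t a (B.control α hρ ht a) := by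
  intro s hs e μ he
  by_cases he0 : e = 0
  · simp [he0]
  -- A nonzero coordinate forces `μ = B.eig i`, so the nonresonance hypothesis on `Λ` in `U` applies
  -- to this eigenvalue of the extension.
  obtain ⟨i, hi⟩ : ∃ i, B.dualBasis.repr e i ≠ 0 := by
    by_contra! h
    exact he0 (B.eq_of_repr_eq fun i => by simp [h i])
  have hμ : μ = B.eig i := by
    have hei := (B.mem_extGraph_iff _).1 he i
    simp only [map_smul, lp.coeFn_smul, Pi.smul_apply, smul_eq_mul] at hei
    exact mul_right_cancel₀ hi hei
  have hpos : 0 < μ := hμ ▸ B.eig_pos i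
  have hdisc : ρ ^ 2 * μ ^ (2 * α) - 4 * μ ≠ 0 := by
    have h := hρμ μ ⟨B.basis i, B.mem_domain i⟩ (B.basis.orthonormal.ne_zero i)
      (hμ ▸ B.op_basis i)
    rw [Real.rpow_sub hpos, Real.rpow_one] at h
    intro h0
    apply h
    have := Real.rpow_pos_of_pos hpos (2 * α)
    field_simp
    linarith
  rw [coeffZero_add_deriv_coeffOne hpos hdisc, ← Complex.ofReal_mul]
  congr 1
  refine B.inner_eq_of_repr_eq (g := fun μ => controlCoeff (√μ) (ρ * μ ^ α) t s) (fun j => ?_) he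
  rw [repr_control, controlSeq_apply, projIcc_of_mem ht.le hs]

/-- The state at time `t` vanishes coordinate by coordinate, by the scalar identity for each block.
`K` is kept abstract so that one computation serves both systems. -/
theorem steers_coordGraph {α ρ t T : ℝ} (hρ : 0 < ρ) (ht : 0 < t)
    {K : VDual Λ →L[ℝ] lp (fun _ : ι => ℂ) 2}
    (hK : ∀ a i, K a i = B.dualBasis.repr a i • Complex.I) (a : VDual Λ) :
    Steers (coordGraph B.eig α ρ) K T t (K a) (B.control α hρ ht a) := by
  have hA : ∀ i z, inner ℝ (blockOp (√(B.eig i)) (ρ * B.eig i ^ α) z) z ≤ 0 := fun i =>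
    blockOp_dissipative _ (mul_nonneg hρ.le (Real.rpow_nonneg (B.eig_pos i).le _))
  set S := blockSemigroup (fun i => blockOp (√(B.eig i)) (ρ * B.eig i ^ α)) hA with hS
  set v := B.control α hρ ht a with hv
  refine ⟨B.memLp_control α hρ ht a T, _, ⟨S, isC0Semigroup_blockSemigroup _ hA, ?_,
    fun _ _ => rfl⟩, ?_⟩
  · rw [generatorGraph_blockSemigroup, closure_coordGraph]
  -- Continuity gives the integrability needed to take coordinates inside the integral.
  have hcont : Continuous fun r => S (t - r) (K (v r)) := by
    refine continuous_iff_continuousAt.2 fun s =>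
      tendsto_lp_of_dominated (summable_sq_norm_lp ((20 / t) • B.dualBasis.repr a))
        (Eventually.of_forall fun r i => ?_) fun i => ?_
    · refine (norm_flow_le (hA i) (le_max_right _ _) _).trans ?_
      rw [hK, norm_smul, Complex.norm_I, mul_one, hv, repr_control]
      exact B.norm_controlSeq_apply_le α hρ ht a r i
    · refine Continuous.tendsto ?_ s
      have h1 : Continuous fun r =>
          flow (blockOp (√(B.eig i)) (ρ * B.eig i ^ α)) r Complex.I :=
        continuous_iff_continuousAt.2 fun s => (hasDerivAt_flow _ Complex.I s).continuousAt
      have h2 : ∀ r, S (t - r) (K (v r)) i = B.controlSeq α hρ ht a r i •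
          flow (blockOp (√(B.eig i)) (ρ * B.eig i ^ α)) (max (t - r) 0) Complex.I := fun r => by
        rw [hS, blockSemigroup, blockDiag_apply, hK, map_smul, hv, repr_control]
      simp only [h2]
      exact (B.continuous_controlSeq_apply α hρ ht a i).smul
        (h1.comp ((continuous_const.sub continuous_id).max continuous_const))
  ext i
  have hint : (∫ r in (0 : ℝ)..t, S (t - r) (K (v r))) i =
      ∫ r in (0 : ℝ)..t, S (t - r) (K (v r)) i :=
    ((lp.evalCLM ℝ (fun _ : ι => ℂ) 2 i).intervalIntegral_comp_comm
      (hcont.intervalIntegrable 0 t)).symm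
  have hcongr : ∫ r in (0 : ℝ)..t, S (t - r) (K (v r)) i =
      ∫ r in (0 : ℝ)..t, B.dualBasis.repr a i •
        flow (blockOp (√(B.eig i)) (ρ * B.eig i ^ α)) (t - r)
          (controlCoeff (√(B.eig i)) (ρ * B.eig i ^ α) t r • Complex.I) := by
    refine intervalIntegral.integral_congr fun r hr => ?_
    rw [uIcc_of_le ht.le] at hr
    simp only
    rw [hS, blockSemigroup_apply _ hA (sub_nonneg.2 hr.2), hK, hv, repr_control,
      controlSeq_apply, projIcc_of_mem ht.le hr, map_smul, map_smul, smul_smul, mul_comm]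
  rw [lp.coeFn_add, Pi.add_apply, hint, hcongr, intervalIntegral.integral_smul,
    integral_flow_controlCoeff (B.sqrt_pos i) _ ht, hS, blockSemigroup_apply _ hA ht.le, hK,
    map_smul]
  simp

end EigenBasis

end DampedWave

end

/-! ### Transfer of the coordinate result to both systems -/

theorem mainTheorem8 {U : Type*} [NormedAddCommGroup U] [InnerProductSpace ℝ U] [CompleteSpace U]
    [TopologicalSpace.SeparableSpace U]
    (Λ : DampedWave.PosOp U) (hΛ : DampedWave.IsTraceClass Λ.inv)
    (α ρ : ℝ) (hα : α ∈ Set.Ico (0 : ℝ) 1) (hρ : 0 < ρ)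
    (hρμ : ∀ (μ : ℝ) (x : Λ.op.domain), (x : U) ≠ 0 → Λ.op x = μ • (x : U) →
      ρ ^ 2 ≠ 4 * μ ^ (1 - 2 * α)) :
    ∃ C : ℝ, 0 < C ∧ ∀ (a : DampedWave.VDual Λ) (T t : ℝ), 0 < t → t ≤ T →
      DampedWave.controlEnergy (DampedWave.waveGraphT Λ α ρ) (DampedWave.Gt Λ) T t
          (DampedWave.Gt Λ a) ≤ ENNReal.ofReal (C * ‖a‖ ^ 2 / t) ∧
      DampedWave.controlEnergy (DampedWave.waveGraphT Λ α ρ) (DampedWave.Gt Λ) T t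
          (DampedWave.Gt Λ a) =
        DampedWave.controlEnergy (DampedWave.waveGraph Λ α ρ) (DampedWave.G Λ) T t
          (DampedWave.G Λ a) ∧
      DampedWave.controlEnergy (DampedWave.waveGraph Λ α ρ) (DampedWave.G Λ) T t
          (DampedWave.G Λ a) ≤ ENNReal.ofReal (C * ‖a‖ ^ 2 / t) ∧
      ∃ v : ℝ → DampedWave.VDual Λ, DampedWave.IsSpectralControl Λ α ρ t a v ∧
        DampedWave.Steers (DampedWave.waveGraphT Λ α ρ) (DampedWave.Gt Λ) T t
          (DampedWave.Gt Λ a) v ∧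
        DampedWave.Steers (DampedWave.waveGraph Λ α ρ) (DampedWave.G Λ) T t
          (DampedWave.G Λ a) v ∧
        ∫⁻ s in Set.Ioc 0 t, ‖v s‖ₑ ^ 2 ≤ ENNReal.ofReal (C * ‖a‖ ^ 2 / t) := by
  obtain ⟨ι, ⟨B⟩⟩ := DampedWave.exists_eigenBasis Λ hΛ.isCompactOperator
  set Jt := DampedWave.pairIso B.dualBasis B.dualBasis with hJt
  set J := DampedWave.pairIso B.basis B.dualBasis with hJ
  set K : DampedWave.VDual Λ →L[ℝ] lp (fun _ : ι => ℂ) 2 :=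
    (Jt.toContinuousLinearEquiv : DampedWave.StateHt Λ →L[ℝ] lp (fun _ : ι => ℂ) 2).comp
      (DampedWave.Gt Λ) with hKdef
  have hK : ∀ a i, K a i = B.dualBasis.repr a i • Complex.I := fun a i => by
    apply Complex.ext <;> simp [hKdef, hJt, DampedWave.pairIso_apply, DampedWave.Gt]
  have hGt : ∀ a, Jt (DampedWave.Gt Λ a) = K a := fun a => rfl
  have hG : ∀ a, J (DampedWave.G Λ a) = K a := fun a => by
    ext i
    rw [hK]
    apply Complex.ext <;> simp [hJ, DampedWave.pairIso_apply, DampedWave.G]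
  have hAt := B.waveGraphT_eq α ρ
  have hA := B.waveGraph_eq α ρ
  -- `400 = 20²`, from the pointwise bound `20 / t` on the control.
  refine ⟨400, by norm_num, fun a T t ht htT => ?_⟩
  have hv := B.steers_coordGraph (α := α) (T := T) hρ ht hK a
  have hvt : DampedWave.Steers (DampedWave.waveGraphT Λ α ρ) (DampedWave.Gt Λ) T t
      (DampedWave.Gt Λ a) (B.control α hρ ht a) := by
    rwa [DampedWave.steers_iff Jt hAt hGt, hGt]
  have hvh : DampedWave.Steers (DampedWave.waveGraph Λ α ρ) (DampedWave.G Λ) T t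
      (DampedWave.G Λ a) (B.control α hρ ht a) := by
    rwa [DampedWave.steers_iff J hA hG, hG]
  have hen := B.lintegral_control_le α hρ ht a
  refine ⟨(iInf₂_le _ hvt).trans hen, ?_, (iInf₂_le _ hvh).trans hen, B.control α hρ ht a,
    B.isSpectralControl_control hρ ht hρμ a, hvt, hvh, hen⟩
  -- Both energies equal that of the coordinate system started from `K a`.
  rw [DampedWave.controlEnergy_eq Jt hAt hGt, DampedWave.controlEnergy_eq J hA hG, hGt, hG]
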